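/- A region is a set of unit squares of the square lattice $\mathbb{Z}^2\subset\mathbb{R}^2$. A domino is a union of two unit squares sharing a side, and a domino tiling of a region is a set of non-overlapping dominoes that exactly covers the region. A generalized Aztec pillow is a region of the following kind. Let $n\ge 1$. The central band is the rectangle $[-n,n]\times[-1,1]$, consisting of two rows of $2n$ unit squares. Above and below the band there are finitely many (possibly no) further rows, each a nonempty horizontal interval of unit squares. When one passes from a row to the next row farther from the band, the left end of the row moves to the right by an odd number of unit squares and the right end moves to the left by an odd number of unit squares (all steps off the central band have height one and odd length; the lengths may all be different). A region is rotationally symmetric if it is invariant under the rotation by $180^\circ$ about the origin. The Aztec diamond of order $n\ge 1$ is the union of the unit squares all of whose vertices $(x,y)\in\mathbb{Z}^2$ satisfy $|x|+|y|\le n+1$. The Aztec pillow of order $n\ge 1$ has central band $[-n,n]\times[-1,1]$; above the band, each row begins three unit squares farther to the right and ends one unit square farther to the left than the row below it, as long as there is room for a nonempty row; and the lower half is the image of the upper half under the rotation by $180^\circ$ about the origin. Corollary. The number of domino tilings of any rotationally symmetric generalized Aztec pillow is finite and is a sum of two integer squares $a^2+b^2$ with $a,b\in\mathbb{Z}$.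 Moreover, every Aztec diamond and every Aztec pillow of order $n\ge1$ is a rotationally symmetric generalized Aztec pillow. -/

import Mathlib

/-- A unit lattice square, named by its lower left corner:
`(x, y)` stands for `[x, x + 1] × [y, y + 1]`. A region is a set of unit squares. -/
abbrev Cell : Type := ℤ × ℤ

/-- A domino: two unit squares that share a horizontal or a vertical side. -/
def IsDomino (d : Set Cell) : Prop :=
  ∃ x y : ℤ, d = {(x, y), (x + 1, y)} ∨ d = {(x, y), (x, y + 1)}

/-- A domino tiling of `S`: a set of non-overlapping dominoes that exactly cover `S`. -/
def IsDominoTiling (S : Set Cell) (T : Set (Set Cell)) : Prop :=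
  (∀ d ∈ T, IsDomino d) ∧ T.PairwiseDisjoint id ∧ ⋃₀ T = S

/-- The set of all domino tilings of a region. -/
def dominoTilings (S : Set Cell) : Set (Set (Set Cell)) := {T | IsDominoTiling S T}

/-- Invariance under the rotation by 180 degrees about the origin, which takes the square with
lower left corner `(x, y)` to the one with lower left corner `(-1 - x, -1 - y)`. -/
def IsRotationallySymmetric (S : Set Cell) : Prop :=
  ∀ x y : ℤ, (x, y) ∈ S ↔ (-1 - x, -1 - y) ∈ S

/-- The shape of a generalized Aztec pillow. The central band is `[-n, n] × [-1, 1]`: two rows of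
`2 * n` squares. There are `up` rows above it and `down` rows below it; going away from the band,
the boundary moves inwards from each row to the next by a step of height one and odd length, the
lengths being `nw i` and `ne i` on the left and on the right above the band, and `sw i` and `se i`
on the left and on the right below it. All rows are nonempty. -/
structure GeneralizedAztecPillow where
  n : ℕ
  up : ℕ
  down : ℕ
  nw : ℕ → ℕ
  ne : ℕ → ℕ
  sw : ℕ → ℕ
  se : ℕ → ℕ
  odd_nw : ∀ i < up, Odd (nw i)
  odd_ne : ∀ i < up, Odd (ne i)
  odd_sw : ∀ i < down, Odd (sw i)
  odd_se : ∀ i < down, Odd (se i)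
  /-- The top row (hence every row above the band) is nonempty. -/
  top_nonempty : ∑ i ∈ Finset.range up, nw i + ∑ i ∈ Finset.range up, ne i < 2 * n
  /-- The bottom row (hence every row below the band) is nonempty. -/
  bottom_nonempty : ∑ i ∈ Finset.range down, sw i + ∑ i ∈ Finset.range down, se i < 2 * n

/-- The region formed by the rows of a generalized Aztec pillow. The rows with `j = 0` form the
central band; the `j`-th row above it has lower side at height `j`, and the `j`-th row below it has
lower side at height `-1 - j`. -/
def GeneralizedAztecPillow.region (P : GeneralizedAztecPillow) : Set Cell :=
  {c | (∃ j ≤ P.up, c.2 = (j : ℤ) ∧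
          -(P.n : ℤ) + ∑ i ∈ Finset.range j, (P.nw i : ℤ) ≤ c.1 ∧
          c.1 < (P.n : ℤ) - ∑ i ∈ Finset.range j, (P.ne i : ℤ)) ∨
       (∃ j ≤ P.down, c.2 = -1 - (j : ℤ) ∧
          -(P.n : ℤ) + ∑ i ∈ Finset.range j, (P.sw i : ℤ) ≤ c.1 ∧
          c.1 < (P.n : ℤ) - ∑ i ∈ Finset.range j, (P.se i : ℤ))}

/-- The Aztec diamond of order `n`: all unit squares whose four vertices `(a, b)` satisfy
`|a| + |b| ≤ n + 1`. -/
def aztecDiamond (n : ℕ) : Set Cell :=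
  {c | ∀ a b : ℤ, (a = c.1 ∨ a = c.1 + 1) → (b = c.2 ∨ b = c.2 + 1) →
    |a| + |b| ≤ (n : ℤ) + 1}

/-- The Aztec pillow of order `n`: the two central rows have `2 * n` squares; above them, each row
begins three squares further to the right and ends one square further to the left than the row
below it, for as long as there is room for a nonempty row; the lower half is the image of the upper
half under the rotation by 180 degrees about the origin. -/
def aztecPillow (n : ℕ) : Set Cell :=
  {c | (0 ≤ c.2 ∧ -(n : ℤ) + 3 * c.2 ≤ c.1 ∧ c.1 < (n : ℤ) - c.2) ∨
       (0 ≤ -1 - c.2 ∧ -(n : ℤ) + 3 * (-1 - c.2) ≤ -1 - c.1 ∧ -1 - c.1 < (n : ℤ) - (-1 - c.2))}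

/-! Colour a cell by the parity of the sum of its coordinates. Tilings are the bijections from even
to odd cells that match neighbours, and the signs in `kasteleyn` give all their terms in the
determinant the same sign (`exists_sign_mul_prod_kasteleyn`). So the number of tilings is the
absolute value of that determinant.

The rotation preserves colours. Because the steps have odd length, the parity of the left end of a
row alternates with height, and the rotation changes entries only by the factor in
`kasteleyn_rotateCell`. Listing the upper cells first and then their images, the matrix has blocks
A, B, B, -A. Over the Gaussian integers its determinant is, up to sign, the norm of det(A + iB), a
sum of two squares (`abs_det_fromBlocks_eq_sq_add_sq`). -/

/-! ### Crossing signs of two dominoes -/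

/-- The sign of the comparison of two cells in the row by row order. -/
def rowSign (p q : Cell) : ℤ :=
  if p.2 < q.2 ∨ (p.2 = q.2 ∧ p.1 < q.1) then 1
  else if q.2 < p.2 ∨ (p.2 = q.2 ∧ q.1 < p.1) then -1 else 0

/-- Two cells that share a side. -/
def CellAdj (p q : Cell) : Prop :=
  (p.2 = q.2 ∧ (q.1 = p.1 + 1 ∨ p.1 = q.1 + 1)) ∨ (p.1 = q.1 ∧ (q.2 = p.2 + 1 ∨ p.2 = q.2 + 1))

/-- `-1` if the domino `{p, q}` is vertical and `r` lies to the left of its top cell in the same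
row, and `1` otherwise. -/
def leftSign (p q r : Cell) : ℤ :=
  if p.1 = q.1 ∧ r.2 = max p.2 q.2 ∧ r.1 < p.1 then -1 else 1

theorem rowSign_antisymm (p q : Cell) : rowSign p q = -rowSign q p := by
  unfold rowSign
  split_ifs <;> first | rfl | (exfalso; omega)

theorem rowSign_mul_self {p q : Cell} (h : p ≠ q) : rowSign p q * rowSign p q = 1 := by
  have : p.1 ≠ q.1 ∨ p.2 ≠ q.2 := by
    by_contra! h'
    exact h (Prod.ext h'.1 h'.2)
  unfold rowSign
  split_ifs <;> first | rfl | (exfalso; omega)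

theorem leftSign_comm (p q r : Cell) : leftSign p q r = leftSign q p r := by
  unfold leftSign
  split_ifs <;> first | rfl | (exfalso; omega)

theorem leftSign_left (p q : Cell) : leftSign p q p = 1 := by
  unfold leftSign
  split_ifs <;> first | rfl | (exfalso; omega)

theorem leftSign_right (p q : Cell) : leftSign p q q = 1 := by
  rw [leftSign_comm, leftSign_left]

theorem CellAdj.symm {p q : Cell} (h : CellAdj p q) : CellAdj q p := by
  unfold CellAdj at *
  omega

theorem CellAdj.normalize {p q : Cell} (h : CellAdj p q) :
    (q = (p.1 + 1, p.2) ∨ q = (p.1, p.2 + 1)) ∨ (p = (q.1 + 1, q.2) ∨ p = (q.1, q.2 + 1)) := by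
  obtain ⟨a, b⟩ := p
  obtain ⟨c, d⟩ := q
  simp only [CellAdj, Prod.mk.injEq] at *
  omega

theorem rowSign_mul_eq_leftSign_mul_aux {p q p' q' : Cell}
    (h : q = (p.1 + 1, p.2) ∨ q = (p.1, p.2 + 1))
    (h' : q' = (p'.1 + 1, p'.2) ∨ q' = (p'.1, p'.2 + 1))
    (h1 : p ≠ p') (h2 : p ≠ q') (h3 : q ≠ p') (h4 : q ≠ q') :
    rowSign p p' * rowSign q q' * rowSign p q' * rowSign q p' =
      (leftSign p q p' * leftSign p q q') * (leftSign p' q' p * leftSign p' q' q) := by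
  obtain ⟨a, b⟩ := p
  obtain ⟨c, d⟩ := p'
  -- Dominoes have extent at most two, so only offsets of absolute value at most one need separate
  -- treatment; beyond that every comparison is settled.
  have hb : b < d - 1 ∨ b = d - 1 ∨ b = d ∨ b = d + 1 ∨ b > d + 1 := by omega
  have ha : a < c - 1 ∨ a = c - 1 ∨ a = c ∨ a = c + 1 ∨ a > c + 1 := by omega
  rcases h with rfl | rfl <;> rcases h' with rfl | rfl <;>
    simp only [ne_eq, Prod.mk.injEq, not_and] at h1 h2 h3 h4 <;>
    simp only [rowSign, leftSign] <;>
    rcases hb with hb | hb | hb | hb | hb <;> (try subst hb) <;>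
    rcases ha with ha | ha | ha | ha | ha <;> (try subst ha) <;>
    first
    | (exfalso; omega)
    | (simp (disch := omega) only [if_pos, if_neg]; norm_num <;> (try split_ifs) <;> omega)

/-- Two disjoint dominoes cross in the row by row order if and only if one of them is vertical and
exactly one cell of the other lies to the left of its top cell. -/
theorem rowSign_mul_eq_leftSign_mul {p q p' q' : Cell} (h : CellAdj p q) (h' : CellAdj p' q')
    (h1 : p ≠ p') (h2 : p ≠ q') (h3 : q ≠ p') (h4 : q ≠ q') :
    rowSign p p' * rowSign q q' * rowSign p q' * rowSign q p' =
      (leftSign p q p' * leftSign p q q') * (leftSign p' q' p * leftSign p' q' q) := by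
  rcases h.normalize with h | h <;> rcases h'.normalize with h' | h'
  · exact rowSign_mul_eq_leftSign_mul_aux h h' h1 h2 h3 h4
  · have := rowSign_mul_eq_leftSign_mul_aux h h' h2 h1 h4 h3
    rw [leftSign_comm q' p', leftSign_comm q' p'] at this
    linarith
  · have := rowSign_mul_eq_leftSign_mul_aux h h' h3 h4 h1 h2
    rw [leftSign_comm q p, leftSign_comm q p] at this
    linarith
  · have := rowSign_mul_eq_leftSign_mul_aux h h' h4 h3 h2 h1
    rw [leftSign_comm q p, leftSign_comm q p, leftSign_comm q' p', leftSign_comm q' p'] at this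
    linarith

open Classical in
/-- The signed adjacency matrix of a finite region. -/
noncomputable def kasteleyn (S : Finset Cell) (p q : Cell) : ℤ :=
  if CellAdj p q then rowSign p q * ∏ r ∈ S, leftSign p q r else 0

/-! ### All tilings contribute with the same sign -/

section Sign

variable {n : ℕ} {b w : Fin n → Cell}

/-- Each unordered pair of dominoes contributes one factor for each of its two orders. Regrouped by
domino, these run over the cells of all other dominoes; the domino's own cells contribute 1. -/
theorem prod_crossing_eq_prod_leftSign (hb : b.Injective) (hw : w.Injective)
    (hbw : ∀ i j, b i ≠ w j) (hadj : ∀ i, CellAdj (b i) (w i)) :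
    ∏ i, ∏ j ∈ Finset.Ioi i, (rowSign (b i) (b j) * rowSign (w i) (w j) *
        rowSign (b i) (w j) * rowSign (w i) (b j)) =
      ∏ i, ∏ r ∈ Finset.univ.image b ∪ Finset.univ.image w, leftSign (b i) (w i) r := by
  have key : ∀ i, ∀ j ∈ Finset.Ioi i, rowSign (b i) (b j) * rowSign (w i) (w j) *
        rowSign (b i) (w j) * rowSign (w i) (b j) =
      (leftSign (b i) (w i) (b j) * leftSign (b i) (w i) (w j)) *
        (leftSign (b j) (w j) (b i) * leftSign (b j) (w j) (w i)) := by
    intro i j hj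
    have hij : i ≠ j := (Finset.mem_Ioi.1 hj).ne
    exact rowSign_mul_eq_leftSign_mul (hadj i) (hadj j) (hb.ne hij) (hbw i j) (hbw j i).symm
      (hw.ne hij)
  rw [Finset.prod_congr rfl fun i _ => Finset.prod_congr rfl (key i)]
  rw [Finset.prod_prod_Ioi_mul_eq_prod_prod_off_diag
    fun j i => leftSign (b i) (w i) (b j) * leftSign (b i) (w i) (w j)]
  refine Finset.prod_congr rfl fun i _ => ?_
  rw [Finset.prod_union, Finset.prod_image hb.injOn, Finset.prod_image hw.injOn,
    ← Finset.prod_mul_distrib]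
  · refine Finset.prod_subset (Finset.subset_univ _) fun j _ hj => ?_
    obtain rfl : j = i := by simpa using hj
    rw [leftSign_left, leftSign_right, one_mul]
  · rw [Finset.disjoint_left]
    simp only [Finset.mem_image, Finset.mem_univ, true_and, not_exists]
    rintro _ ⟨i, rfl⟩ j h
    exact hbw i j h.symm

/-- By antisymmetry the mixed black-white factors of the pairs, together with the matched ones, fill
out the product over all pairs `(b i, w j)`, which does not depend on `σ`. Reordering the
white-white factors costs `σ.sign`. -/
theorem prod_crossing_mul (σ : Equiv.Perm (Fin n)) :
    (∏ i, ∏ j ∈ Finset.Ioi i, (rowSign (b i) (b j) * rowSign (w (σ i)) (w (σ j)) *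
        rowSign (b i) (w (σ j)) * rowSign (w (σ i)) (b j))) * ∏ i, rowSign (b i) (w (σ i)) =
      σ.sign * ((∏ i, ∏ j ∈ Finset.Ioi i, rowSign (b i) (b j)) *
        (∏ i, ∏ j ∈ Finset.Ioi i, rowSign (w i) (w j)) *
        (∏ i : Fin n, ∏ _j ∈ Finset.Ioi i, (-1)) * ∏ i, ∏ j, rowSign (b i) (w j)) := by
  have h1 : ∀ i j, rowSign (b i) (b j) * rowSign (w (σ i)) (w (σ j)) *
        rowSign (b i) (w (σ j)) * rowSign (w (σ i)) (b j) =
      rowSign (b i) (b j) * rowSign (w (σ i)) (w (σ j)) * (-1) *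
        (rowSign (b j) (w (σ i)) * rowSign (b i) (w (σ j))) := by
    intro i j
    rw [rowSign_antisymm (w (σ i)) (b j)]
    ring
  simp_rw [h1]
  simp_rw [Finset.prod_mul_distrib (s := Finset.Ioi _), Finset.prod_mul_distrib (s := Finset.univ)]
  have h2 := σ.prod_Ioi_comp_eq_sign_mul_prod (f := fun i j => rowSign (w i) (w j))
    fun _ _ => rowSign_antisymm _ _
  have h3 := Finset.prod_prod_Ioi_mul_eq_prod_prod_off_diag fun j i => rowSign (b j) (w (σ i))
  have h4 : (∏ i, ∏ j ∈ ({i} : Finset (Fin n))ᶜ, rowSign (b j) (w (σ i))) *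
      ∏ i, rowSign (b i) (w (σ i)) = ∏ i, ∏ j, rowSign (b i) (w j) := by
    rw [← Finset.prod_mul_distrib, Finset.prod_comm,
      ← Equiv.prod_comp σ (fun j => ∏ i, rowSign (b i) (w j))]
    refine Finset.prod_congr rfl fun i _ => ?_
    rw [← Finset.prod_compl_mul_prod {i}, Finset.prod_singleton]
  simp_rw [Finset.prod_mul_distrib (s := Finset.Ioi _),
    Finset.prod_mul_distrib (s := Finset.univ)] at h3
  simp only [Int.cast_id] at h2
  rw [h2, ← h4, ← h3]
  ring

theorem exists_sign_mul_prod_kasteleyn (hb : b.Injective) (hw : w.Injective)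
    (hbw : ∀ i j, b i ≠ w j) :
    ∃ c : ℤ, c * c = 1 ∧ ∀ σ : Equiv.Perm (Fin n), (∀ i, CellAdj (b i) (w (σ i))) →
      (σ.sign : ℤ) * ∏ i, kasteleyn (Finset.univ.image b ∪ Finset.univ.image w)
        (b i) (w (σ i)) = c := by
  -- The factor of `prod_crossing_mul` that is free of `σ`.
  refine ⟨(∏ i, ∏ j ∈ Finset.Ioi i, rowSign (b i) (b j)) *
        (∏ i, ∏ j ∈ Finset.Ioi i, rowSign (w i) (w j)) *
        (∏ i : Fin n, ∏ _j ∈ Finset.Ioi i, (-1)) * ∏ i, ∏ j, rowSign (b i) (w j), ?_, ?_⟩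
  · have sq : ∀ f : Fin n → Fin n → ℤ, (∀ i j, i < j → f i j * f i j = 1) →
        (∏ i, ∏ j ∈ Finset.Ioi i, f i j) * (∏ i, ∏ j ∈ Finset.Ioi i, f i j) = 1 := by
      intro f hf
      rw [← Finset.prod_mul_distrib]
      refine Finset.prod_eq_one fun i _ => ?_
      rw [← Finset.prod_mul_distrib]
      exact Finset.prod_eq_one fun j hj => hf i j (Finset.mem_Ioi.1 hj)
    have s1 := sq (fun i j => rowSign (b i) (b j)) fun i j h => rowSign_mul_self (hb.ne h.ne)
    have s2 := sq (fun i j => rowSign (w i) (w j)) fun i j h => rowSign_mul_self (hw.ne h.ne)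
    have s3 := sq (fun _ _ => -1) fun _ _ _ => by norm_num
    have s4 : (∏ i, ∏ j, rowSign (b i) (w j)) * ∏ i, ∏ j, rowSign (b i) (w j) = 1 := by
      simp_rw [← Finset.prod_mul_distrib, rowSign_mul_self (hbw _ _), Finset.prod_const_one]
    generalize (∏ i, ∏ j ∈ Finset.Ioi i, rowSign (b i) (b j)) = x1 at *
    generalize (∏ i, ∏ j ∈ Finset.Ioi i, rowSign (w i) (w j)) = x2 at *
    generalize (∏ i : Fin n, ∏ _j ∈ Finset.Ioi i, (-1 : ℤ)) = x3 at *
    generalize (∏ i, ∏ j, rowSign (b i) (w j)) = x4 at *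
    calc _ = (x1 * x1) * (x2 * x2) * (x3 * x3) * (x4 * x4) := by ring
      _ = 1 := by rw [s1, s2, s3, s4]; norm_num
  · intro σ hσ
    have c1 := prod_crossing_eq_prod_leftSign hb (hw.comp σ.injective) (fun i j => hbw i (σ j)) hσ
    have c2 := prod_crossing_mul (b := b) (w := w) σ
    have himg : Finset.univ.image (w ∘ σ) = Finset.univ.image w := by
      rw [← Finset.image_image, Finset.image_univ_equiv]
    rw [himg] at c1
    simp only [Function.comp_apply] at c1
    rw [c1] at c2
    simp_rw [kasteleyn, if_pos (hσ _), Finset.prod_mul_distrib]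
    rw [mul_comm (∏ i, rowSign (b i) (w (σ i))), c2, ← mul_assoc, ← Units.val_mul,
      Int.units_mul_self, Units.val_one, one_mul]

open Classical in
theorem exists_mul_det_kasteleyn (hb : b.Injective) (hw : w.Injective)
    (hbw : ∀ i j, b i ≠ w j) :
    ∃ c : ℤ, c * c = 1 ∧
      ({σ : Equiv.Perm (Fin n) | ∀ i, CellAdj (b i) (w (σ i))}.ncard : ℤ) =
        c * (Matrix.of fun i j => kasteleyn (Finset.univ.image b ∪ Finset.univ.image w)
          (b i) (w j)).det := by
  obtain ⟨c, hc, h⟩ := exists_sign_mul_prod_kasteleyn hb hw hbw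
  refine ⟨c, hc, ?_⟩
  -- The Leibniz formula permutes row indices, whereas here `σ` acts on columns.
  rw [← Matrix.det_transpose, Matrix.det_apply']
  have : ∀ σ : Equiv.Perm (Fin n), ((σ.sign : ℤ) : ℤ) *
      ∏ i, kasteleyn (Finset.univ.image b ∪ Finset.univ.image w) (b i) (w (σ i)) =
      if ∀ i, CellAdj (b i) (w (σ i)) then c else 0 := by
    intro σ
    split_ifs with hσ
    · exact h σ hσ
    · push Not at hσ
      obtain ⟨i, hi⟩ := hσ
      rw [Finset.prod_eq_zero (Finset.mem_univ i) (by rw [kasteleyn, if_neg hi]), mul_zero]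
  simp only [Matrix.transpose_apply, Matrix.of_apply, Int.cast_id, this]
  rw [Finset.sum_ite, Finset.sum_const_zero, add_zero, Finset.sum_const, nsmul_eq_mul,
    mul_left_comm, hc, mul_one, Set.ncard_eq_toFinset_card', Set.toFinset_ofPred]

end Sign

/-! ### Tilings as matchings of even with odd cells -/

section Tilings

variable {S : Set Cell} {T : Set (Set Cell)}

theorem CellAdj.ne {p q : Cell} (h : CellAdj p q) : p ≠ q := by
  rintro rfl
  unfold CellAdj at h
  omega

theorem CellAdj.isDomino {p q : Cell} (h : CellAdj p q) : IsDomino {p, q} := by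
  rcases h.normalize with (rfl | rfl) | (rfl | rfl)
  · exact ⟨p.1, p.2, Or.inl rfl⟩
  · exact ⟨p.1, p.2, Or.inr rfl⟩
  · exact ⟨q.1, q.2, Or.inl (Set.pair_comm _ _)⟩
  · exact ⟨q.1, q.2, Or.inr (Set.pair_comm _ _)⟩

theorem IsDomino.exists_adj {d : Set Cell} (h : IsDomino d) {p : Cell} (hp : p ∈ d) :
    ∃ q, CellAdj p q ∧ d = {p, q} := by
  obtain ⟨x, y, rfl | rfl⟩ := h
  · rcases hp with rfl | rfl
    · exact ⟨(x + 1, y), by simp [CellAdj], rfl⟩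
    · exact ⟨(x, y), by simp [CellAdj], Set.pair_comm _ _⟩
  · rcases hp with rfl | rfl
    · exact ⟨(x, y + 1), by simp [CellAdj], rfl⟩
    · exact ⟨(x, y), by simp [CellAdj], Set.pair_comm _ _⟩

theorem IsDominoTiling.exists_adj (h : IsDominoTiling S T) {p : Cell} (hp : p ∈ S) :
    ∃ q ∈ S, CellAdj p q ∧ {p, q} ∈ T := by
  rw [← h.2.2] at hp ⊢
  obtain ⟨d, hd, hpd⟩ := hp
  obtain ⟨q, hq, rfl⟩ := (h.1 d hd).exists_adj hpd
  exact ⟨q, ⟨_, hd, by simp⟩, hq, hd⟩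

theorem IsDominoTiling.eq_of_mem (h : IsDominoTiling S T) {d d' : Set Cell} (hd : d ∈ T)
    (hd' : d' ∈ T) {p : Cell} (hp : p ∈ d) (hp' : p ∈ d') : d = d' := by
  by_contra hne
  exact Set.disjoint_left.1 (h.2.1 hd hd' hne) hp hp'

theorem IsDominoTiling.left_unique (h : IsDominoTiling S T) {p p' q : Cell} (hp : {p, q} ∈ T)
    (hp' : {p', q} ∈ T) (hadj : CellAdj p' q) : p' = p := by
  have h1 := h.eq_of_mem hp hp' (p := q) (by simp) (by simp)
  have h2 : p' ∈ ({p, q} : Set Cell) := by rw [h1]; simp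
  exact h2.resolve_right hadj.ne

theorem finite_dominoTilings (hS : S.Finite) : (dominoTilings S).Finite := by
  refine hS.finite_subsets.finite_subsets.subset fun T hT d hd => ?_
  show d ⊆ S
  rw [← hT.2.2]
  exact Set.subset_sUnion_of_mem hd

/-- Sending a cell to its partner in its domino is injective and switches the class. -/
theorem IsDominoTiling.card_filter_le {S : Finset Cell} (h : IsDominoTiling (S : Set Cell) T)
    (P : Cell → Prop) [DecidablePred P] (hP : ∀ p q, CellAdj p q → (P p ↔ ¬P q)) :
    (S.filter P).card ≤ (S.filter fun p => ¬P p).card := by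
  choose! f hf using fun p (hp : p ∈ (S : Set Cell)) => h.exists_adj hp
  refine Finset.card_le_card_of_injOn f ?_ ?_
  · intro p hp
    obtain ⟨hp, hPp⟩ := Finset.mem_filter.1 hp
    obtain ⟨h1, h2, -⟩ := hf p hp
    exact Finset.mem_coe.2 (Finset.mem_filter.2 ⟨h1, (hP _ _ h2).1 hPp⟩)
  · intro p hp p' hp' heq
    obtain ⟨-, -, h1⟩ := hf p (Finset.mem_filter.1 hp).1
    obtain ⟨-, h2, h3⟩ := hf p' (Finset.mem_filter.1 hp').1
    rw [← heq] at h2 h3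
    exact (h.left_unique h1 h3 h2).symm

theorem CellAdj.even_iff {p q : Cell} (h : CellAdj p q) :
    Even (p.1 + p.2) ↔ ¬Even (q.1 + q.2) := by
  unfold CellAdj at h
  rw [Int.even_iff, Int.even_iff]
  omega

theorem IsDominoTiling.card_even_eq {S : Finset Cell} (h : IsDominoTiling (S : Set Cell) T) :
    (S.filter fun p => Even (p.1 + p.2)).card = (S.filter fun p => ¬Even (p.1 + p.2)).card := by
  refine le_antisymm (h.card_filter_le _ fun p q => CellAdj.even_iff) ?_
  have := h.card_filter_le (fun p => ¬Even (p.1 + p.2)) fun p q hpq => not_congr hpq.even_iff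
  simpa only [not_not] using this

theorem ncard_dominoTilings {n : ℕ} {b w : Fin n → Cell} (hb : b.Injective) (hw : w.Injective)
    (heb : ∀ i, Even ((b i).1 + (b i).2)) (hew : ∀ i, ¬Even ((w i).1 + (w i).2))
    (hS : S = Set.range b ∪ Set.range w) :
    (dominoTilings S).ncard =
      {σ : Equiv.Perm (Fin n) | ∀ i, CellAdj (b i) (w (σ i))}.ncard := by
  have hbw : ∀ i j, b i ≠ w j := fun i j h => hew j (h ▸ heb i)
  have himg : dominoTilings S =
      (fun σ : Equiv.Perm (Fin n) => Set.range fun i => ({b i, w (σ i)} : Set Cell)) ''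
        {σ : Equiv.Perm (Fin n) | ∀ i, CellAdj (b i) (w (σ i))} := by
    ext T
    constructor
    · intro hT
      have hex : ∀ i, ∃ j, CellAdj (b i) (w j) ∧ {b i, w j} ∈ T := by
        intro i
        obtain ⟨q, hqS, hq, hqT⟩ := IsDominoTiling.exists_adj hT (p := b i) (by simp [hS])
        rw [hS] at hqS
        rcases hqS with ⟨j, rfl⟩ | ⟨j, rfl⟩
        · exact absurd (heb j) (hq.even_iff.1 (heb i))
        · exact ⟨j, hq, hqT⟩
      choose f hf using hex
      have hinj : f.Injective := by
        intro i i' heq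
        have h2 := hf i'
        rw [← heq] at h2
        exact (hb (IsDominoTiling.left_unique hT (hf i).2 h2.2 h2.1)).symm
      refine ⟨Equiv.ofBijective f (Finite.injective_iff_bijective.1 hinj), fun i => (hf i).1, ?_⟩
      ext d
      simp only [Equiv.ofBijective_apply, Set.mem_range]
      constructor
      · rintro ⟨i, rfl⟩
        exact (hf i).2
      · intro hd
        obtain ⟨x, hx⟩ : d.Nonempty := by
          obtain ⟨x, y, rfl | rfl⟩ := hT.1 d hd <;> exact ⟨_, Or.inl rfl⟩
        have hxS : x ∈ S := by
          rw [← hT.2.2]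
          exact ⟨d, hd, hx⟩
        rw [hS] at hxS
        rcases hxS with ⟨i, rfl⟩ | ⟨j, rfl⟩
        · exact ⟨i, IsDominoTiling.eq_of_mem hT (hf i).2 hd (p := b i) (by simp) hx⟩
        · obtain ⟨i, rfl⟩ := (Finite.injective_iff_surjective.1 hinj) j
          exact ⟨i, IsDominoTiling.eq_of_mem hT (hf i).2 hd (p := w (f i)) (by simp) hx⟩
    · rintro ⟨σ, hσ, rfl⟩
      refine ⟨?_, ?_, ?_⟩
      · rintro _ ⟨i, rfl⟩
        exact (hσ i).isDomino
      · rintro _ ⟨i, rfl⟩ _ ⟨j, rfl⟩ hne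
        have hij : i ≠ j := by
          rintro rfl
          exact hne rfl
        simp only [Function.onFun, id]
        rw [Set.disjoint_left]
        rintro x (rfl | rfl) (h | h)
        · exact hij (hb h)
        · exact hbw _ _ h
        · exact hbw _ _ h.symm
        · exact hij (σ.injective (hw h))
      · rw [hS]
        ext x
        simp only [Set.mem_sUnion, Set.mem_range, exists_exists_eq_and, Set.mem_insert_iff,
          Set.mem_singleton_iff, Set.mem_union]
        constructor
        · rintro ⟨i, rfl | rfl⟩
          · exact Or.inl ⟨i, rfl⟩
          · exact Or.inr ⟨_, rfl⟩
        · rintro (⟨i, rfl⟩ | ⟨j, rfl⟩)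
          · exact ⟨i, Or.inl rfl⟩
          · exact ⟨σ.symm j, Or.inr (by simp)⟩
  rw [himg]
  refine Set.InjOn.ncard_image ?_
  intro σ hσ τ hτ heq
  ext i : 1
  have hmem : ({b i, w (σ i)} : Set Cell) ∈ Set.range fun i => ({b i, w (τ i)} : Set Cell) := by
    exact (Set.ext_iff.1 heq _).1 ⟨i, rfl⟩
  obtain ⟨j, hj⟩ := hmem
  simp only at hj
  have h1 : b i ∈ ({b j, w (τ j)} : Set Cell) := by rw [hj]; simp
  have h2 : w (τ j) ∈ ({b i, w (σ i)} : Set Cell) := by rw [← hj]; simp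
  obtain rfl : i = j := hb (h1.resolve_right (hbw _ _))
  exact (hw (h2.resolve_left (hbw _ _).symm)).symm

end Tilings

/-! ### Block determinants and Gaussian norms -/

section SumOfSquares

variable {ι : Type*} [Fintype ι] [DecidableEq ι]

/-- Adding i times the second block row to the first, then i times the first block column to the
second, clears the upper right block and leaves A + iB and -(A - iB) on the diagonal. Their
determinants are conjugate up to sign. -/
theorem abs_det_fromBlocks_eq_sq_add_sq (A B : Matrix ι ι ℤ) :
    ∃ a b : ℤ, |(Matrix.fromBlocks A B B (-A)).det| = a ^ 2 + b ^ 2 := by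
  let I : GaussianInt := ⟨0, 1⟩
  have hI : I * I = -1 := by ext <;> simp [I]
  let A' : Matrix ι ι GaussianInt := A.map (Int.castRingHom GaussianInt)
  let B' : Matrix ι ι GaussianInt := B.map (Int.castRingHom GaussianInt)
  have hmul : Matrix.fromBlocks 1 (I • (1 : Matrix ι ι GaussianInt)) 0 1 *
      Matrix.fromBlocks A' B' B' (-A') * Matrix.fromBlocks 1 (I • (1 : Matrix ι ι GaussianInt)) 0 1
      = Matrix.fromBlocks (A' + I • B') 0 B' (-(A' - I • B')) := by
    simp only [Matrix.fromBlocks_multiply]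
    congr 1
    · simp
    · simp [smul_smul, hI]
    · simp
    · simp
      abel
  have hdet := congrArg Matrix.det hmul
  rw [Matrix.det_mul, Matrix.det_mul, Matrix.det_fromBlocks_zero₂₁, Matrix.det_fromBlocks_zero₁₂,
    Matrix.det_one, Matrix.det_neg] at hdet
  have hstar : (A' - I • B').det = star (A' + I • B').det := by
    change _ = starRingEnd GaussianInt _
    rw [RingHom.map_det]
    congr 1
    ext i j <;> simp [A', B', I, starRingEnd_apply]
  have hcast : (Matrix.fromBlocks A' B' B' (-A')).det =
      (((Matrix.fromBlocks A B B (-A)).det : ℤ) : GaussianInt) := by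
    have := RingHom.map_det (Int.castRingHom GaussianInt) (Matrix.fromBlocks A B B (-A))
    rw [eq_intCast] at this
    rw [this]
    congr 1
    rw [RingHom.mapMatrix_apply, Matrix.fromBlocks_map, Matrix.map_neg _ (map_neg _)]
  rw [hstar, hcast, one_mul, one_mul, mul_one, mul_left_comm, ← Zsqrtd.norm_eq_mul_conj] at hdet
  have hint : (Matrix.fromBlocks A B B (-A)).det =
      (-1) ^ Fintype.card ι * (A' + I • B').det.norm := by
    exact_mod_cast hdet
  refine ⟨(A' + I • B').det.re, (A' + I • B').det.im, ?_⟩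
  rw [hint, abs_mul, abs_pow, abs_neg, abs_one, one_pow, one_mul, Zsqrtd.abs_norm (by norm_num),
    Zsqrtd.norm_def]
  ring

end SumOfSquares

/-! ### Rotation and the block form of the matrix -/

/-- The rotation by 180 degrees about the origin. -/
def rotateCell (p : Cell) : Cell := (-1 - p.1, -1 - p.2)

theorem rotateCell_rotateCell (p : Cell) : rotateCell (rotateCell p) = p := by
  simp [rotateCell]

theorem rotateCell_injective : Function.Injective rotateCell :=
  Function.LeftInverse.injective rotateCell_rotateCell

theorem even_rotateCell (p : Cell) :
    Even ((rotateCell p).1 + (rotateCell p).2) ↔ Even (p.1 + p.2) := by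
  simp only [rotateCell, Int.even_iff]
  omega

theorem cellAdj_rotateCell (p q : Cell) : CellAdj (rotateCell p) (rotateCell q) ↔ CellAdj p q := by
  simp only [rotateCell, CellAdj]
  omega

/-- `1` on the upper half-plane and `-1` on the lower one. -/
def halfSign (p : Cell) : ℤ := if 0 ≤ p.2 then 1 else -1

theorem kasteleyn_antisymm (S : Finset Cell) (p q : Cell) :
    kasteleyn S p q = -kasteleyn S q p := by
  unfold kasteleyn
  by_cases h : CellAdj p q
  · rw [if_pos h, if_pos h.symm, rowSign_antisymm]
    simp_rw [leftSign_comm p q, neg_mul]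
  · rw [if_neg h, if_neg fun h' => h h'.symm, neg_zero]

theorem kasteleyn_horizontal (S : Finset Cell) (x y : ℤ) :
    kasteleyn S (x, y) (x + 1, y) = 1 := by
  simp [kasteleyn, CellAdj, rowSign, leftSign]

/-- The data of a rotationally symmetric region whose rows have left ends `l y` of the same
parities as the rows of a generalized Aztec pillow. -/
structure IsPillowLike (S : Finset Cell) (n : ℤ) (l : ℤ → ℤ) : Prop where
  rotate : ∀ p, rotateCell p ∈ S ↔ p ∈ S
  left : ∀ x y, (x, y) ∈ S → ∀ x' ≤ x, ((x', y) ∈ S ↔ l y ≤ x')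
  even_upper : ∀ x y, (x, y) ∈ S → 0 ≤ y → Even (l y + n + y)
  even_lower : ∀ x y, (x, y) ∈ S → y < 0 → Even (l y + n + y + 1)

namespace IsPillowLike

variable {S : Finset Cell} {n : ℤ} {l : ℤ → ℤ}

/-- The row of the top cell has no gaps to the left of that cell, so exactly `x - l (y + 1)` cells
contribute -1. -/
theorem kasteleyn_vertical (h : IsPillowLike S n l) {x y : ℤ} (hq : (x, y + 1) ∈ S) :
    kasteleyn S (x, y) (x, y + 1) = if Even (x + l (y + 1)) then 1 else -1 := by
  have hle : l (y + 1) ≤ x := (h.left x (y + 1) hq x le_rfl).1 hq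
  have hadj : CellAdj (x, y) (x, y + 1) := by simp [CellAdj]
  have hrow : rowSign (x, y) (x, y + 1) = 1 := by simp [rowSign]
  have hfilter : (S.filter fun r => r.2 = y + 1 ∧ r.1 < x) =
      (Finset.Ico (l (y + 1)) x).image fun x' => ((x', y + 1) : Cell) := by
    ext ⟨a, c⟩
    simp only [Finset.mem_filter, Finset.mem_image, Finset.mem_Ico, Prod.mk.injEq]
    constructor
    · rintro ⟨h1, rfl, h2⟩
      exact ⟨a, ⟨(h.left x _ hq a h2.le).1 h1, h2⟩, rfl, rfl⟩
    · rintro ⟨a, ⟨h1, h2⟩, rfl, rfl⟩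
      exact ⟨(h.left x _ hq a h2.le).2 h1, rfl, h2⟩
  have hprod : ∏ r ∈ S, leftSign (x, y) (x, y + 1) r = (-1) ^ (x - l (y + 1)).toNat := by
    have : ∀ r : Cell, leftSign (x, y) (x, y + 1) r =
        if r.2 = y + 1 ∧ r.1 < x then -1 else 1 := by
      intro r
      simp [leftSign]
    simp_rw [this]
    rw [Finset.prod_ite, Finset.prod_const_one, mul_one, Finset.prod_const, hfilter,
      Finset.card_image_of_injective _ fun a b hab => (Prod.mk.inj hab).1, Int.card_Ico]
  rw [kasteleyn, if_pos hadj, hrow, one_mul, hprod]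
  split_ifs with hev
  · refine Even.neg_one_pow ?_
    rw [Int.even_iff] at hev
    rw [Nat.even_iff]
    omega
  · refine Odd.neg_one_pow ?_
    rw [Int.even_iff] at hev
    rw [Nat.odd_iff]
    omega

/-- Rotation reverses the row order, which gives the minus sign. For a vertical domino the top cell
becomes the bottom one; by the parities of the left ends, the count to the left keeps its parity
within a half-plane and changes it when the domino straddles the axis. `halfSign` records that
change. -/
theorem kasteleyn_rotateCell_aux (h : IsPillowLike S n l) {p q : Cell} (hp : p ∈ S) (hq : q ∈ S)
    (hpq : q = (p.1 + 1, p.2) ∨ q = (p.1, p.2 + 1)) :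
    kasteleyn S (rotateCell p) (rotateCell q) = -(halfSign p * halfSign q * kasteleyn S p q) := by
  obtain ⟨x, y⟩ := p
  rw [kasteleyn_antisymm]
  rcases hpq with rfl | rfl
  · have h1 := kasteleyn_horizontal S (-1 - (x + 1)) (-1 - y)
    rw [show -1 - (x + 1) + 1 = -1 - x by ring] at h1
    simp only [rotateCell]
    rw [h1, kasteleyn_horizontal]
    simp only [halfSign]
    split_ifs <;> norm_num
  · have hp' := (h.rotate _).2 hp
    have h1 := h.kasteleyn_vertical hq
    have h2 := h.kasteleyn_vertical (x := -1 - x) (y := -1 - (y + 1)) (by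
      rw [show -1 - (y + 1) + 1 = -1 - y by ring]
      exact hp')
    rw [show -1 - (y + 1) + 1 = -1 - y by ring] at h2
    simp only [rotateCell]
    rw [h1, h2]
    have e1 := h.even_upper _ _ hq
    have e2 := h.even_lower _ _ hq
    have e3 := h.even_upper _ _ hp'
    have e4 := h.even_lower _ _ hp'
    simp only [Int.even_iff] at *
    simp only [halfSign]
    split_ifs <;> first | rfl | (exfalso; omega)

theorem kasteleyn_rotateCell (h : IsPillowLike S n l) {p q : Cell} (hp : p ∈ S) (hq : q ∈ S) :
    kasteleyn S (rotateCell p) (rotateCell q) = -(halfSign p * halfSign q * kasteleyn S p q) := by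
  by_cases hadj : CellAdj p q
  · rcases hadj.normalize with hpq | hpq
    · exact h.kasteleyn_rotateCell_aux hp hq hpq
    · rw [kasteleyn_antisymm, h.kasteleyn_rotateCell_aux hq hp hpq, kasteleyn_antisymm S q p]
      ring
  · rw [kasteleyn, if_neg fun h' => hadj ((cellAdj_rotateCell p q).1 h'), kasteleyn, if_neg hadj,
      mul_zero, neg_zero]

theorem card_filter_eq (h : IsPillowLike S n l) (P : Cell → Prop) [DecidablePred P]
    (hP : ∀ p, P (rotateCell p) ↔ P p) :
    (S.filter P).card = 2 * (S.filter fun p => P p ∧ 0 ≤ p.2).card := by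
  rw [← Finset.card_filter_add_card_filter_not (s := S.filter P) fun p => 0 ≤ p.2,
    Finset.filter_filter, Finset.filter_filter, two_mul]
  congr 1
  refine Finset.card_nbij' rotateCell rotateCell ?_ ?_ (fun p _ => rotateCell_rotateCell p)
    fun p _ => rotateCell_rotateCell p
  · intro p hp
    simp only [Finset.coe_filter, Set.mem_ofPred_eq, h.rotate, hP] at hp ⊢
    exact ⟨hp.1, hp.2.1, by simp only [rotateCell]; omega⟩
  · intro p hp
    simp only [Finset.coe_filter, Set.mem_ofPred_eq, h.rotate, hP] at hp ⊢
    exact ⟨hp.1, hp.2.1, by simp only [rotateCell]; omega⟩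

/-- An enumeration of the cells with a rotation-invariant property, where the two summands
correspond to the two half-planes. -/
theorem exists_enum (h : IsPillowLike S n l) (P : Cell → Prop) [DecidablePred P]
    (hP : ∀ p, P (rotateCell p) ↔ P p) {k : ℕ}
    (hk : (S.filter fun p => P p ∧ 0 ≤ p.2).card = k) :
    ∃ f : Fin k ⊕ Fin k → Cell, f.Injective ∧ (∀ p, p ∈ Set.range f ↔ p ∈ S ∧ P p) ∧
      ∀ i, halfSign (f (.inl i)) = 1 ∧ f (.inr i) = rotateCell (f (.inl i)) := by
  let e := (Finset.equivFinOfCardEq hk).symm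
  have he : ∀ i, (e i : Cell) ∈ S ∧ P (e i) ∧ 0 ≤ (e i : Cell).2 :=
    fun i => Finset.mem_filter.1 (e i).2
  refine ⟨Sum.elim (fun i => e i) fun i => rotateCell (e i), ?_, ?_, ?_⟩
  · refine Function.Injective.sumElim (Subtype.val_injective.comp e.injective)
      (rotateCell_injective.comp (Subtype.val_injective.comp e.injective)) ?_
    intro i j hij
    have h1 := (he i).2.2
    have h2 := (he j).2.2
    rw [hij] at h1
    simp only [rotateCell] at h1
    omega
  · intro p
    constructor
    · rintro ⟨i | i, rfl⟩
      · exact ⟨(he i).1, (he i).2.1⟩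
      · exact ⟨(h.rotate _).2 (he i).1, (hP _).2 (he i).2.1⟩
    · rintro ⟨hpS, hp⟩
      by_cases h0 : 0 ≤ p.2
      · exact ⟨.inl (e.symm ⟨p, Finset.mem_filter.2 ⟨hpS, hp, h0⟩⟩), by simp⟩
      · refine ⟨.inr (e.symm ⟨rotateCell p, Finset.mem_filter.2
          ⟨(h.rotate _).2 hpS, (hP _).2 hp, by simp only [rotateCell]; omega⟩⟩), ?_⟩
        simp [rotateCell_rotateCell]
  · intro i
    exact ⟨if_pos (he i).2.2, rfl⟩

/-- A tiling forces equally many cells of each colour, and the rotation halves both counts, so all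
four blocks are square of one size. Without tilings, 0 = 0² + 0². -/
theorem exists_ncard_eq (h : IsPillowLike S n l) :
    ∃ a b : ℤ, ((dominoTilings (S : Set Cell)).ncard : ℤ) = a ^ 2 + b ^ 2 := by
  rcases (dominoTilings (S : Set Cell)).eq_empty_or_nonempty with hempty | ⟨T, hT⟩
  · exact ⟨0, 0, by simp [hempty]⟩
  have hcard := IsDominoTiling.card_even_eq hT
  rw [h.card_filter_eq _ even_rotateCell,
    h.card_filter_eq (fun p => ¬Even (p.1 + p.2)) fun p => not_congr (even_rotateCell p)] at hcard
  obtain ⟨k, hk⟩ : ∃ k, (S.filter fun p : Cell => Even (p.1 + p.2) ∧ 0 ≤ p.2).card = k := ⟨_, rfl⟩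
  obtain ⟨f, hf, hfS, hfR⟩ := h.exists_enum _ even_rotateCell hk
  obtain ⟨g, hg, hgS, hgR⟩ := h.exists_enum (fun p => ¬Even (p.1 + p.2))
    (fun p => not_congr (even_rotateCell p)) (k := k) (by omega)
  let s : Fin (k + k) ≃ Fin k ⊕ Fin k := finSumFinEquiv.symm
  have hfe : ∀ i, f i ∈ S ∧ Even ((f i).1 + (f i).2) := fun i => (hfS _).1 ⟨i, rfl⟩
  have hge : ∀ i, g i ∈ S ∧ ¬Even ((g i).1 + (g i).2) := fun i => (hgS _).1 ⟨i, rfl⟩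
  have hS : (S : Set Cell) = Set.range (f ∘ s) ∪ Set.range (g ∘ s) := by
    rw [s.surjective.range_comp, s.surjective.range_comp]
    ext p
    rw [Set.mem_union, hfS, hgS, Finset.mem_coe]
    tauto
  have hS' : Finset.univ.image (f ∘ s) ∪ Finset.univ.image (g ∘ s) = S := by
    apply Finset.coe_injective
    rw [hS]
    simp only [Finset.coe_union, Finset.coe_image, Finset.coe_univ, Set.image_univ]
  rw [ncard_dominoTilings (hf.comp s.injective) (hg.comp s.injective)
    (fun i => (hfe _).2) (fun i => (hge _).2) hS]
  obtain ⟨c, hc, hdet⟩ := exists_mul_det_kasteleyn (hf.comp s.injective) (hg.comp s.injective)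
    fun i j hij => (hge (s j)).2 ((show f (s i) = g (s j) from hij) ▸ (hfe (s i)).2)
  rw [hS'] at hdet
  let A : Matrix (Fin k) (Fin k) ℤ := .of fun i j => kasteleyn S (f (.inl i)) (g (.inl j))
  let B : Matrix (Fin k) (Fin k) ℤ := .of fun i j => kasteleyn S (f (.inl i)) (g (.inr j))
  have hM : (Matrix.of fun i j => kasteleyn S ((f ∘ s) i) ((g ∘ s) j)) =
      (Matrix.fromBlocks A B B (-A)).submatrix s s := by
    ext i j
    simp only [Matrix.of_apply, Function.comp_apply, Matrix.submatrix_apply]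
    rcases s i with i | i <;> rcases s j with j | j
    · rfl
    · rfl
    -- The lower left block is B again: the rotated column cell lies in the lower half, so its
    -- `halfSign` cancels the minus sign.
    · have h1 := h.kasteleyn_rotateCell (hfe (.inl i)).1 (hge (.inr j)).1
      rw [← (hfR i).2, (hgR j).2, rotateCell_rotateCell, (hfR i).1, ← (hgR j).2] at h1
      have h2 : halfSign (g (.inr j)) = -1 := by
        have h3 := (hgR j).1
        rw [(hgR j).2]
        simp only [halfSign, rotateCell] at h3 ⊢
        split_ifs at h3 ⊢ <;> first | rfl | omega
      rw [h1, h2, Matrix.fromBlocks_apply₂₁]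
      simp [B]
    · rw [(hfR i).2, (hgR j).2, h.kasteleyn_rotateCell (hfe _).1 (hge _).1, (hfR i).1, (hgR j).1]
      simp [A]
  rw [hM, Matrix.det_submatrix_equiv_self] at hdet
  obtain ⟨a, b, hab⟩ := abs_det_fromBlocks_eq_sq_add_sq A B
  refine ⟨a, b, ?_⟩
  have habs : |c| = 1 := by
    rcases mul_self_eq_one_iff.1 hc with rfl | rfl <;> simp
  rw [← hab, ← one_mul |_|, ← habs, ← abs_mul, ← hdet, Nat.abs_cast]

end IsPillowLike

/-! ### Left-end parities of generalized pillows -/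

namespace GeneralizedAztecPillow

/-- The left end of the row at height `y`. -/
def leftEnd (P : GeneralizedAztecPillow) (y : ℤ) : ℤ :=
  if 0 ≤ y then -(P.n : ℤ) + ∑ i ∈ Finset.range y.toNat, (P.nw i : ℤ)
  else -(P.n : ℤ) + ∑ i ∈ Finset.range (-1 - y).toNat, (P.sw i : ℤ)

theorem finite_region (P : GeneralizedAztecPillow) : P.region.Finite := by
  refine (Set.finite_Icc ((-(P.n : ℤ), -1 - (P.down : ℤ)) : Cell) (P.n, P.up)).subset ?_
  rintro ⟨x, y⟩ (⟨j, hj, hy, h1, h2⟩ | ⟨j, hj, hy, h1, h2⟩)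
  · have s1 : 0 ≤ ∑ i ∈ Finset.range j, (P.nw i : ℤ) := Finset.sum_nonneg fun _ _ => by positivity
    have s2 : 0 ≤ ∑ i ∈ Finset.range j, (P.ne i : ℤ) := Finset.sum_nonneg fun _ _ => by positivity
    simp only [Set.mem_Icc, Prod.mk_le_mk] at *
    omega
  · have s1 : 0 ≤ ∑ i ∈ Finset.range j, (P.sw i : ℤ) := Finset.sum_nonneg fun _ _ => by positivity
    have s2 : 0 ≤ ∑ i ∈ Finset.range j, (P.se i : ℤ) := Finset.sum_nonneg fun _ _ => by positivity
    simp only [Set.mem_Icc, Prod.mk_le_mk] at *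
    omega

/-- This is where the odd step lengths enter: a sum of `j` odd numbers has the parity of `j`. -/
theorem even_sum_add {f : ℕ → ℕ} {m : ℕ} (hf : ∀ i < m, Odd (f i)) {j : ℕ} (hj : j ≤ m) :
    Even (∑ i ∈ Finset.range j, (f i : ℤ) + j) := by
  induction j with
  | zero => simp
  | succ j ih =>
    have h1 := ih (by omega)
    have h2 := hf j (by omega)
    rw [Finset.sum_range_succ]
    rw [Nat.odd_iff] at h2
    rw [Int.even_iff] at *
    push_cast
    omega

theorem isPillowLike (P : GeneralizedAztecPillow) (h : IsRotationallySymmetric P.region) :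
    IsPillowLike P.finite_region.toFinset P.n P.leftEnd where
  rotate p := by
    simp only [Set.Finite.mem_toFinset]
    exact (h p.1 p.2).symm
  left x y hxy x' hx' := by
    simp only [Set.Finite.mem_toFinset] at *
    rcases hxy with ⟨j, hj, hy, h1, h2⟩ | ⟨j, hj, hy, h1, h2⟩
    · simp only at hy h1 h2
      subst hy
      simp only [leftEnd, Int.natCast_nonneg, if_true, Int.toNat_natCast]
      constructor
      · rintro (⟨i, hi, hij, h3, h4⟩ | ⟨i, hi, hij, h3, h4⟩)
        · obtain rfl : j = i := by simpa using hij
          exact h3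
        · simp only at hij
          omega
      · intro h3
        exact Or.inl ⟨j, hj, rfl, h3, lt_of_le_of_lt hx' h2⟩
    · simp only at hy h1 h2
      subst hy
      have hneg : ¬(0 : ℤ) ≤ -1 - (j : ℤ) := by omega
      simp only [leftEnd, if_neg hneg, sub_sub_cancel, Int.toNat_natCast]
      constructor
      · rintro (⟨i, hi, hij, h3, h4⟩ | ⟨i, hi, hij, h3, h4⟩)
        · simp only at hij
          omega
        · obtain rfl : j = i := by simpa using hij
          exact h3
      · intro h3
        exact Or.inr ⟨j, hj, rfl, h3, lt_of_le_of_lt hx' h2⟩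
  even_upper x y hxy hy := by
    simp only [Set.Finite.mem_toFinset] at hxy
    rcases hxy with ⟨j, hj, hjy, -⟩ | ⟨j, hj, hjy, -⟩
    · simp only at hjy
      subst hjy
      have := even_sum_add P.odd_nw hj
      simp only [leftEnd, if_pos hy, Int.toNat_natCast]
      rw [Int.even_iff] at *
      omega
    · simp only at hjy
      omega
  even_lower x y hxy hy := by
    simp only [Set.Finite.mem_toFinset] at hxy
    rcases hxy with ⟨j, hj, hjy, -⟩ | ⟨j, hj, hjy, -⟩
    · simp only at hjy
      omega
    · simp only at hjy
      subst hjy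
      have := even_sum_add P.odd_sw hj
      simp only [leftEnd, if_neg hy.not_ge, sub_sub_cancel, Int.toNat_natCast]
      rw [Int.even_iff] at *
      omega

end GeneralizedAztecPillow

/-! ### Aztec diamonds and Aztec pillows as examples -/

theorem mem_aztecDiamond (n : ℕ) (x y : ℤ) :
    (x, y) ∈ aztecDiamond n ↔
      (0 ≤ y ∧ -(n : ℤ) + y ≤ x ∧ x < n - y) ∨
        (y < 0 ∧ -(n : ℤ) + (-1 - y) ≤ x ∧ x < n - (-1 - y)) := by
  simp only [aztecDiamond, Set.mem_ofPred_eq, abs_eq_max_neg]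
  constructor
  · intro h
    have h1 := h x y (Or.inl rfl) (Or.inl rfl)
    have h2 := h x (y + 1) (Or.inl rfl) (Or.inr rfl)
    have h3 := h (x + 1) y (Or.inr rfl) (Or.inl rfl)
    have h4 := h (x + 1) (y + 1) (Or.inr rfl) (Or.inr rfl)
    omega
  · rintro h a b (rfl | rfl) (rfl | rfl) <;> omega

/-- The Aztec diamond as a generalized Aztec pillow. -/
def diamondPillow (n : ℕ) (hn : 1 ≤ n) : GeneralizedAztecPillow where
  n := n
  up := n - 1
  down := n - 1
  nw _ := 1
  ne _ := 1
  sw _ := 1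
  se _ := 1
  odd_nw _ _ := odd_one
  odd_ne _ _ := odd_one
  odd_sw _ _ := odd_one
  odd_se _ _ := odd_one
  top_nonempty := by simp; omega
  bottom_nonempty := by simp; omega

theorem region_diamondPillow (n : ℕ) (hn : 1 ≤ n) :
    (diamondPillow n hn).region = aztecDiamond n := by
  ext ⟨x, y⟩
  rw [mem_aztecDiamond]
  simp only [GeneralizedAztecPillow.region, diamondPillow, Set.mem_ofPred_eq, Nat.cast_one,
    Finset.sum_const, Finset.card_range, nsmul_eq_mul, mul_one]
  constructor
  · rintro (⟨j, hj, rfl, h1, h2⟩ | ⟨j, hj, rfl, h1, h2⟩) <;> omega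
  · rintro (⟨h0, h1, h2⟩ | ⟨h0, h1, h2⟩)
    · exact Or.inl ⟨y.toNat, by omega, by omega, by omega, by omega⟩
    · exact Or.inr ⟨(-1 - y).toNat, by omega, by omega, by omega, by omega⟩

/-- The Aztec pillow as a generalized Aztec pillow. -/
def standardPillow (n : ℕ) (hn : 1 ≤ n) : GeneralizedAztecPillow where
  n := n
  -- Row `j` has `2 * n - 4 * j` cells, which is positive exactly for `j ≤ (n - 1) / 2`.
  up := (n - 1) / 2
  down := (n - 1) / 2
  nw _ := 3
  ne _ := 1
  sw _ := 1
  se _ := 3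
  odd_nw _ _ := by decide
  odd_ne _ _ := odd_one
  odd_sw _ _ := odd_one
  odd_se _ _ := by decide
  top_nonempty := by simp; omega
  bottom_nonempty := by simp; omega

theorem region_standardPillow (n : ℕ) (hn : 1 ≤ n) :
    (standardPillow n hn).region = aztecPillow n := by
  ext ⟨x, y⟩
  simp only [GeneralizedAztecPillow.region, standardPillow, aztecPillow, Set.mem_ofPred_eq,
    Nat.cast_one, Nat.cast_ofNat, Finset.sum_const, Finset.card_range, nsmul_eq_mul, mul_one]
  constructor
  · rintro (⟨j, hj, rfl, h1, h2⟩ | ⟨j, hj, rfl, h1, h2⟩) <;> omega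
  · rintro (⟨h0, h1, h2⟩ | ⟨h0, h1, h2⟩)
    · exact Or.inl ⟨y.toNat, by omega, by omega, by omega, by omega⟩
    · exact Or.inr ⟨(-1 - y).toNat, by omega, by omega, by omega, by omega⟩

theorem mainTheorem6 :
    (∀ P : GeneralizedAztecPillow, IsRotationallySymmetric P.region →
      (dominoTilings P.region).Finite ∧
      ∃ a b : ℤ, ((dominoTilings P.region).ncard : ℤ) = a ^ 2 + b ^ 2) ∧
    (∀ n : ℕ, 1 ≤ n →
      (∃ P : GeneralizedAztecPillow, P.region = aztecDiamond n) ∧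
      IsRotationallySymmetric (aztecDiamond n)) ∧
    (∀ n : ℕ, 1 ≤ n →
      (∃ P : GeneralizedAztecPillow, P.region = aztecPillow n) ∧
      IsRotationallySymmetric (aztecPillow n)) := by
  refine ⟨fun P hP => ⟨finite_dominoTilings P.finite_region, ?_⟩,
    fun n hn => ⟨⟨_, region_diamondPillow n hn⟩, fun x y => ?_⟩,
    fun n hn => ⟨⟨_, region_standardPillow n hn⟩, fun x y => ?_⟩⟩
  · have := (P.isPillowLike hP).exists_ncard_eq
    rwa [Set.Finite.coe_toFinset] at this
  · rw [mem_aztecDiamond, mem_aztecDiamond]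
    omega
  · simp only [aztecPillow, Set.mem_ofPred_eq]
    omega
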